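/- A function is *normal* if it is strictly increasing and continuous, and a function $g$ from an ordinal to an ordinal is *regressive* if $g(\alpha)<\alpha$ for all $\alpha>0$ in its domain. For a regular cardinal $\delta\geq\omega_2$, Friedman's property $F(\delta)$ states that for every regressive $g\colon\delta\to 2$ there is a normal function $f\colon\omega_1\to\delta$ such that $g\circ f$ is constant. For cardinals $\kappa\leq\lambda$ with $\kappa$ uncountable, $\kappa$ is *$\lambda$-supercompact* if there is a $\kappa$-complete, fine, normal ultrafilter $U$ on $P_\kappa(\lambda)=\{x\subseteq\lambda : |x|<\kappa\}$; here *fine* means $\{x : a\in x\}\in U$ for every $a\in\lambda$, and *normal* means that every $h\colon P_\kappa(\lambda)\to\lambda$ with $\{x : h(x)\in x\}\in U$ is constant on a set in $U$. (Equivalently, there is an elementary embedding $j\colon V\to M$ into a transitive class $M$ with critical point $\kappa$, $j(\kappa)>\lambda$ and ${}^{\lambda}M\subseteq M$.) **Theorem.** Let $\kappa\leq\lambda$ be cardinals such that $\kappa$ is $\lambda$-supercompact. Assume that $F(\delta)$ fails for all regular cardinals $\delta$ with $\omega_2\leq\delta<\kappa$. Then $F(\lambda^+)$ fails. -/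

import Mathlib

open Cardinal Ordinal

universe u

/-- A function defined on the ordinals below `γ` is regressive if `g α < α` for all `0 < α < γ`. -/
def IsRegressive {γ β : Ordinal.{u}} (g : Set.Iio γ → Set.Iio β) : Prop :=
  ∀ α : Set.Iio γ, 0 < (α : Ordinal.{u}) → (g α : Ordinal.{u}) < α

/-- Friedman's property `F(μ, δ)`, used for regular `δ ≥ ω₂`: for every regressive `g : δ → μ`
there is a normal (strictly increasing and continuous) function `f : ω₁ → δ` such that `g ∘ f`
is constant. -/
def FriedmanProperty₂ (μ δ : Cardinal.{u}) : Prop :=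
  ∀ g : Set.Iio δ.ord → Set.Iio μ.ord, IsRegressive g →
    ∃ f : Set.Iio (ω₁ : Ordinal.{u}) → Set.Iio δ.ord, Order.IsNormal f ∧ ∃ c, ∀ i, g (f i) = c

/-- Friedman's property `F(δ)`, which is `F(2, δ)`. -/
def FriedmanProperty (δ : Cardinal.{u}) : Prop :=
  FriedmanProperty₂ 2 δ

/-- `P_κ(lam)`: the subsets of `lam` of cardinality less than `κ`. -/
abbrev SmallSubsets (κ lam : Cardinal.{u}) : Type u :=
  {x : Set lam.ord.ToType // #x < κ}

/-- `U` is a `κ`-complete, fine and normal ultrafilter on `P_κ(lam)`. -/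
structure IsNormalFineMeasure {κ lam : Cardinal.{u}} (U : Ultrafilter (SmallSubsets κ lam)) :
    Prop where
  complete : ∀ S : Set (Set (SmallSubsets κ lam)), #S < κ → (∀ A ∈ S, A ∈ U) → ⋂₀ S ∈ U
  fine : ∀ a : lam.ord.ToType, {x : SmallSubsets κ lam | a ∈ x.1} ∈ U
  normal : ∀ h : SmallSubsets κ lam → lam.ord.ToType,
    {x | h x ∈ x.1} ∈ U → ∃ a, {x | h x = a} ∈ U

/-- `κ` is `lam`-supercompact: `κ` is an uncountable cardinal, `κ ≤ lam`, and `P_κ(lam)` carries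
a `κ`-complete fine normal ultrafilter. -/
def IsSupercompactUpTo (κ lam : Cardinal.{u}) : Prop :=
  ℵ₀ < κ ∧ κ ≤ lam ∧ ∃ U : Ultrafilter (SmallSubsets κ lam), IsNormalFineMeasure U

/-!
The proof is the ultrapower argument carried out on functions, without forming the ultrapower.

Let `U` be a normal fine measure on `P_κ(lam)`. Completeness and fineness make `κ` a strong limit
(`IsNormalFineMeasure.two_power_lt`), so for `U`-almost every `x` the successor `|x|⁺` is a regular
cardinal in `[ω₂, κ)`, and there is a `g x : |x|⁺ → 2` witnessing the failure of `F(|x|⁺)`.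
In the ultrapower `x ↦ |x|⁺` represents `lam⁺`. To see this concretely, fix for each `α < lam⁺` an
injection `i α : α → lam`; then `α` is represented by `x ↦ f α x`, the order type of
`{ξ < α | i α ξ ∈ x}`, which is below `|x|⁺`. Normality gives coherence
(`IsNormalFineMeasure.eventually_coherent`): for `ξ < α < β`, almost every `x` satisfies
`i α ξ ∈ x ↔ i β ξ ∈ x`, simultaneously in all `ξ`. Hence, for fewer than `κ` many `α` at a time,
almost every `x` is such that `f α x` is the order type of an initial segment of one set of ordinals
independent of `α`.

The witness against `F(lam⁺)` is `G α = lim_U (g x (f α x))`. If `h : ω₁ → lam⁺` were normal with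
`G ∘ h` constant, then, as `ω₁ < κ`, completeness would provide a single `x` at which all of the
`ℵ₁` many coherence conditions and all the equalities `g x (f (h j) x) = c` hold. For
this `x`, the map `j ↦ f (h j) x` is normal from `ω₁` to `|x|⁺` and homogeneous for `g x`, which is
impossible.
-/

open Filter Order

/-! ### Order types of initial segments of a set of ordinals -/

/-- The order type of `A ∩ α`, for a set `A` of ordinals, defined by recursion on `α` so that it
lives in the same universe as `α`. -/
noncomputable def initialOrderType (A : Set Ordinal.{u}) (α : Ordinal.{u}) : Ordinal.{u} :=
  ⨆ ξ : {ξ : Set.Iio α // ξ.1 ∈ A}, succ (initialOrderType A ξ.1.1)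
termination_by α
decreasing_by exact ξ.1.2

theorem lt_initialOrderType_iff {A : Set Ordinal.{u}} {α γ : Ordinal.{u}} :
    γ < initialOrderType A α ↔ ∃ ξ < α, ξ ∈ A ∧ γ ≤ initialOrderType A ξ := by
  rw [initialOrderType, Ordinal.lt_iSup_iff]
  constructor
  · rintro ⟨ξ, h⟩
    exact ⟨ξ.1.1, ξ.1.2, ξ.2, lt_succ_iff.1 h⟩
  · rintro ⟨ξ, h, hA, hle⟩
    exact ⟨⟨⟨ξ, h⟩, hA⟩, lt_succ_iff.2 hle⟩

theorem initialOrderType_lt {A : Set Ordinal.{u}} {ξ α : Ordinal.{u}} (hA : ξ ∈ A) (h : ξ < α) :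
    initialOrderType A ξ < initialOrderType A α :=
  lt_initialOrderType_iff.2 ⟨ξ, h, hA, le_rfl⟩

theorem initialOrderType_congr {A B : Set Ordinal.{u}} {α : Ordinal.{u}}
    (h : ∀ ξ < α, ξ ∈ A ↔ ξ ∈ B) : initialOrderType A α = initialOrderType B α := by
  induction α using WellFoundedLT.induction with
  | ind α ih =>
    refine eq_of_forall_lt_iff fun γ => ?_
    rw [lt_initialOrderType_iff, lt_initialOrderType_iff]
    refine exists_congr fun ξ => and_congr_right fun hξ => ?_
    rw [h ξ hξ, ih ξ hξ fun ζ hζ => h ζ (hζ.trans hξ)]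

theorem initialOrderType_le (A : Set Ordinal.{u}) (α : Ordinal.{u}) :
    initialOrderType A α ≤ α := by
  induction α using WellFoundedLT.induction with
  | ind α ih =>
    refine le_of_forall_lt fun γ hγ => ?_
    obtain ⟨ξ, hξ, -, hle⟩ := lt_initialOrderType_iff.1 hγ
    exact (hle.trans (ih ξ hξ)).trans_lt hξ

/-- Every ordinal below the order type of `A ∩ α` is the order type of `A ∩ ξ` for some
`ξ ∈ A ∩ α`. -/
theorem exists_initialOrderType_eq {A : Set Ordinal.{u}} {α γ : Ordinal.{u}}
    (h : γ < initialOrderType A α) : ∃ ξ < α, ξ ∈ A ∧ initialOrderType A ξ = γ := by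
  induction α using WellFoundedLT.induction with
  | ind α ih =>
    obtain ⟨ξ, hξ, hA, hle⟩ := lt_initialOrderType_iff.1 h
    rcases hle.eq_or_lt with heq | hlt
    · exact ⟨ξ, hξ, hA, heq.symm⟩
    · obtain ⟨ζ, hζ, hB, heq⟩ := ih ξ hξ hlt
      exact ⟨ζ, hζ.trans hξ, hB, heq⟩

/-- If `i` is injective on `α`, the order type of `{ξ < α | i ξ ∈ x}` is below `|x|⁺`. -/
theorem initialOrderType_preimage_lt {T : Type u} {x : Set T} {α : Ordinal.{u}}
    {i : Ordinal.{u} → T} (hi : Set.InjOn i (Set.Iio α)) :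
    initialOrderType (i ⁻¹' x) α < (succ #x).ord := by
  rw [← Cardinal.card_le_iff, ← Cardinal.lift_le.{u + 1}, ← Cardinal.mk_Iio_ordinal]
  choose p hp hpx hpe using fun γ : Set.Iio (initialOrderType (i ⁻¹' x) α) =>
    exists_initialOrderType_eq γ.2
  have hinj : Function.Injective fun γ => (⟨i (p γ), hpx γ⟩ : x) := by
    intro γ γ' h
    have := hi (hp γ) (hp γ') (Subtype.ext_iff.1 h)
    exact Subtype.ext (by rw [← hpe γ, ← hpe γ', this])
  simpa using Cardinal.lift_mk_le_lift_mk_of_injective hinj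

/-! ### Normal fine measures -/

namespace IsNormalFineMeasure

variable {κ lam : Cardinal.{u}} {U : Ultrafilter (SmallSubsets κ lam)}

theorem eventually_forall (hU : IsNormalFineMeasure U) {ι : Type*}
    (hι : Cardinal.lift.{u} #ι < Cardinal.lift κ) {p : ι → SmallSubsets κ lam → Prop}
    (h : ∀ j, ∀ᶠ x in U, p j x) : ∀ᶠ x in U, ∀ j, p j x := by
  have := hU.complete (Set.range fun j => {x | p j x})
    (Cardinal.lift_lt.1 (Cardinal.mk_range_le_lift.trans_lt hι)) (by rintro _ ⟨j, rfl⟩; exact h j)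
  filter_upwards [this] with x hx j
  exact hx _ ⟨j, rfl⟩

theorem exists_eventually_eq (hU : IsNormalFineMeasure U) {ι : Type*}
    (hι : Cardinal.lift.{u} #ι < Cardinal.lift κ) (φ : SmallSubsets κ lam → ι) :
    ∃ c, ∀ᶠ x in U, φ x = c := by
  by_contra hc
  have : ∀ᶠ x in U, ∀ c, φ x ≠ c :=
    hU.eventually_forall hι fun c => Ultrafilter.eventually_not.2 fun h => hc ⟨c, h⟩
  obtain ⟨x, hx⟩ := this.exists
  exact hx _ rfl

/-- Choosing for each `x` an element of a fixed set of size `κ` outside `x` gives a nonprincipal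
measure on that set. An injection of the set into `2 ^ μ` with `μ < κ` would make it principal. -/
theorem two_power_lt (hU : IsNormalFineMeasure U) (hle : κ ≤ lam) {μ : Cardinal.{u}}
    (hμ : μ < κ) : 2 ^ μ < κ := by
  by_contra! hcon
  obtain ⟨F⟩ : Nonempty (κ.out ↪ Set μ.out) := by
    rw [← Cardinal.le_def]; simpa using hcon
  obtain ⟨e⟩ : Nonempty (κ.out ↪ lam.ord.ToType) := by
    rw [← Cardinal.le_def]; simpa using hle
  have hp : ∀ x : SmallSubsets κ lam, ∃ a, e a ∉ x.1 := by
    intro x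
    by_contra! hx
    have : Function.Injective fun a => (⟨e a, hx a⟩ : x.1) := fun a b h =>
      e.injective (Subtype.ext_iff.1 h)
    have := Cardinal.mk_le_of_injective this
    rw [Cardinal.mk_out] at this
    exact this.not_gt x.2
  choose p hp using hp
  have hS : ∀ᶠ x in U, ∀ t, t ∈ F (p x) ↔ ∀ᶠ y in U, t ∈ F (p y) := by
    refine hU.eventually_forall (by simpa using hμ) fun t => ?_
    by_cases ht : ∀ᶠ y in U, t ∈ F (p y)
    · filter_upwards [ht] with x hx using iff_of_true hx ht
    · filter_upwards [Ultrafilter.eventually_not.2 ht] with x hx using iff_of_false hx ht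
  obtain ⟨x₀, hx₀⟩ := hS.exists
  obtain ⟨x, hx, hfine⟩ := (hS.and (hU.fine (e (p x₀)))).exists
  have : p x = p x₀ := F.injective (Set.ext fun t => (hx t).trans (hx₀ t).symm)
  exact hp x (this ▸ hfine)

theorem succ_lt (hU : IsNormalFineMeasure U) (hle : κ ≤ lam) {μ : Cardinal.{u}}
    (hμ : μ < κ) : succ μ < κ :=
  (succ_le_of_lt (Cardinal.cantor μ)).trans_lt (hU.two_power_lt hle hμ)

theorem eventually_le_mk (hU : IsNormalFineMeasure U) (hle : κ ≤ lam) {μ : Cardinal.{u}}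
    (hμ : μ < κ) : ∀ᶠ x : SmallSubsets κ lam in U, μ ≤ #x.1 := by
  obtain ⟨e⟩ : Nonempty (μ.out ↪ lam.ord.ToType) := by
    rw [← Cardinal.le_def]; simpa using hμ.le.trans hle
  filter_upwards [hU.eventually_forall (by simpa using hμ) fun t : μ.out => hU.fine (e t)]
    with x hx
  have : Function.Injective fun a => (⟨e a, hx a⟩ : x.1) := fun a b h =>
    e.injective (Subtype.ext_iff.1 h)
  simpa using Cardinal.mk_le_of_injective this

theorem eventually_closed (hU : IsNormalFineMeasure U)
    (k : lam.ord.ToType → lam.ord.ToType) : ∀ᶠ x : SmallSubsets κ lam in U, ∀ a ∈ x.1, k a ∈ x.1 := by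
  classical
  by_contra hcon
  have hnot := Ultrafilter.eventually_not.2 hcon
  obtain ⟨x₀, hx₀⟩ := hnot.exists
  push Not at hx₀
  obtain ⟨a₀, -⟩ := hx₀
  let h : SmallSubsets κ lam → lam.ord.ToType := fun x =>
    if hx : ∃ a ∈ x.1, k a ∉ x.1 then hx.choose else a₀
  have hh : ∀ᶠ x in U, h x ∈ x.1 ∧ k (h x) ∉ x.1 := by
    filter_upwards [hnot] with x hx
    push Not at hx
    simp only [h, dif_pos hx]
    exact hx.choose_spec
  obtain ⟨a, ha⟩ := hU.normal h (hh.mono fun x hx => hx.1)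
  obtain ⟨x, ⟨hx, hxa⟩, hk⟩ := ((hh.and ha).and (hU.fine (k a))).exists
  exact hx.2 (hxa ▸ hk)

/-- Two injections of the same set of ordinals into `lam` pull almost every `x` back to the same
set: almost every `x` is closed under the induced partial bijection of `lam` and its inverse. -/
theorem eventually_coherent (hU : IsNormalFineMeasure U) {s : Set Ordinal.{u}}
    {i j : Ordinal.{u} → lam.ord.ToType} (hi : Set.InjOn i s) (hj : Set.InjOn j s) :
    ∀ᶠ x : SmallSubsets κ lam in U, ∀ ξ ∈ s, i ξ ∈ x.1 ↔ j ξ ∈ x.1 := by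
  have key : ∀ {i j : Ordinal.{u} → lam.ord.ToType}, Set.InjOn i s →
      ∀ᶠ x : SmallSubsets κ lam in U, ∀ ξ ∈ s, i ξ ∈ x.1 → j ξ ∈ x.1 := by
    intro i j hi
    filter_upwards [hU.eventually_closed fun a => j (Function.invFunOn i s a)] with x hx ξ hξ hmem
    simpa [hi.leftInvOn_invFunOn hξ] using hx _ hmem
  filter_upwards [key hi (j := j), key hj (j := i)] with x h₁ h₂ ξ hξ
  exact ⟨h₁ ξ hξ, h₂ ξ hξ⟩

end IsNormalFineMeasure

/-! ### Transfer of the failure of Friedman's property -/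

/-- A counterexample to `F(δ)`, extended to all ordinals. -/
theorem exists_of_not_friedmanProperty {δ : Cardinal.{u}} (h : ¬ FriedmanProperty δ) :
    ∃ g : Ordinal.{u} → Set.Iio (2 : Cardinal.{u}).ord,
      (∀ α < δ.ord, 0 < α → (g α : Ordinal.{u}) < α) ∧
      ∀ f : Set.Iio (ω₁ : Ordinal.{u}) → Set.Iio δ.ord, IsNormal f →
        ∀ c, ∃ j, g (f j) ≠ c := by
  classical
  simp only [FriedmanProperty, FriedmanProperty₂] at h
  push Not at h
  obtain ⟨g, hg, hf⟩ := h
  have h0 : (0 : Ordinal.{u}) < (2 : Cardinal.{u}).ord := by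
    rw [Cardinal.lt_ord, Ordinal.card_zero]; norm_num
  refine ⟨fun α => if hα : α < δ.ord then g ⟨α, hα⟩ else ⟨0, h0⟩, fun α hα hpos => ?_,
    fun f hn c => ?_⟩
  · simpa only [dif_pos hα] using hg ⟨α, hα⟩ hpos
  · obtain ⟨j, hj⟩ := hf f hn c
    refine ⟨j, ?_⟩
    have hlt : (f j : Ordinal.{u}) < δ.ord := (f j).2
    simpa only [dif_pos hlt] using hj

/-- Every ordinal below `lam⁺` injects into `lam`; the injection is extended to all ordinals by a
junk value. -/
theorem exists_injOn_toType {lam : Cardinal.{u}} (hlam : lam ≠ 0) {α : Ordinal.{u}}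
    (hα : α < (succ lam).ord) : ∃ i : Ordinal.{u} → lam.ord.ToType, Set.InjOn i (Set.Iio α) := by
  have : Nonempty lam.ord.ToType := by
    rw [← Cardinal.mk_ne_zero_iff]; simpa using hlam
  obtain ⟨e⟩ : Nonempty (Set.Iio α ↪ lam.ord.ToType) := by
    rw [← Cardinal.lift_mk_le', Cardinal.mk_Iio_ordinal]
    simpa [-Ordinal.lift_card, ← Ordinal.lift_card] using Cardinal.card_le_iff.2 hα
  exact (Set.exists_injOn_iff_injective).2 ⟨e, e.injective⟩

/-- Let `h` be normal, and let the sets `A j` be coherent along `h`, that is, `A k` contains `h j`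
and agrees with `A j` below `h j` for `j < k`. Then replacing each term `h j` by the order type of
`A j ∩ h j` gives a normal function. -/
theorem Order.IsNormal.initialOrderType_comp {δ ε γ : Ordinal.{u}} {h : Set.Iio γ → Set.Iio δ}
    (hn : IsNormal h) {f : Set.Iio γ → Set.Iio ε} {A : Set.Iio γ → Set Ordinal.{u}}
    (hf : ∀ j, (f j : Ordinal.{u}) = initialOrderType (A j) (h j))
    (hcoh : ∀ j k, j < k → ∀ ξ < (h j : Ordinal.{u}), ξ ∈ A j ↔ ξ ∈ A k)
    (hmem : ∀ j k, j < k → (h j : Ordinal.{u}) ∈ A k) : IsNormal f := by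
  have hval : ∀ j k, j < k → (f j : Ordinal.{u}) = initialOrderType (A k) (h j) := fun j k hjk =>
    (hf j).trans (initialOrderType_congr (hcoh j k hjk))
  refine isNormal_iff.2 ⟨fun j k hjk => ?_, fun o ho a ha => ?_⟩
  · rw [← Subtype.coe_lt_coe, hval j k hjk, hf k]
    exact initialOrderType_lt (hmem j k hjk) (hn.strictMono hjk)
  · rw [← Subtype.coe_le_coe, hf o]
    refine le_of_forall_lt fun β hβ => ?_
    obtain ⟨ξ, hξ, hA, rfl⟩ := exists_initialOrderType_eq hβ
    obtain ⟨j, hj, hξj⟩ :=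
      (hn.lt_iff_exists_lt ho (b := ⟨ξ, hξ.trans (h o).2⟩)).1 hξ
    calc initialOrderType (A o) ξ < initialOrderType (A o) (h j) := initialOrderType_lt hA hξj
      _ = f j := (hval j o hj).symm
      _ ≤ a := ha j hj

theorem mainTheorem6 (κ lam : Cardinal.{u}) (hle : κ ≤ lam) (hsc : IsSupercompactUpTo κ lam)
    (hF : ∀ δ : Cardinal.{u}, δ.IsRegular → ℵ_ 2 ≤ δ → δ < κ → ¬ FriedmanProperty δ) :
    ¬ FriedmanProperty (Order.succ lam) := by
  obtain ⟨hκ, -, U, hU⟩ := hsc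
  have hω₁ : ℵ₁ < κ := by
    rw [← Cardinal.succ_aleph0]; exact hU.succ_lt hle hκ
  have hlam : lam ≠ 0 := ((Cardinal.aleph0_pos.trans hκ).trans_le hle).ne'
  -- Counterexamples on the sets of size at least `ℵ₁`, which form a set in `U`.
  have hg : ∀ x : SmallSubsets κ lam, ∃ g : Ordinal.{u} → Set.Iio (2 : Cardinal.{u}).ord,
      ℵ₁ ≤ #x.1 → (∀ α < (succ #x.1).ord, 0 < α → (g α : Ordinal.{u}) < α) ∧
      ∀ f : Set.Iio (ω₁ : Ordinal.{u}) → Set.Iio (succ #x.1).ord, IsNormal f →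
        ∀ c, ∃ j, g (f j) ≠ c := by
    intro x
    by_cases hx : ℵ₁ ≤ #x.1
    · obtain ⟨g, hg⟩ := exists_of_not_friedmanProperty <| hF (succ #x.1)
        (Cardinal.isRegular_succ ((Cardinal.aleph0_le_aleph 1).trans hx))
        (by rw [← one_add_one_eq_two, ← Cardinal.succ_aleph]
            exact succ_le_succ hx)
        (hU.succ_lt hle x.2)
      exact ⟨g, fun _ => hg⟩
    · exact ⟨fun _ => ⟨0, by rw [Set.mem_Iio, Cardinal.lt_ord, Ordinal.card_zero]; norm_num⟩,
        fun h => absurd h hx⟩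
  choose g hg using hg
  have hi : ∀ α : Ordinal.{u}, ∃ i : Ordinal.{u} → lam.ord.ToType,
      α < (succ lam).ord → Set.InjOn i (Set.Iio α) := by
    intro α
    by_cases hα : α < (succ lam).ord
    · obtain ⟨i, hi⟩ := exists_injOn_toType hlam hα
      exact ⟨i, fun _ => hi⟩
    · have : Nonempty lam.ord.ToType := by
        rw [← Cardinal.mk_ne_zero_iff]; simpa using hlam
      exact ⟨fun _ => Classical.arbitrary _, fun h => absurd h hα⟩
  choose i hi using hi
  -- In the ultrapower, `α < lam⁺` is represented by `f α`.
  let f : Ordinal.{u} → SmallSubsets κ lam → Ordinal.{u} := fun α x =>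
    initialOrderType (i α ⁻¹' x.1) α
  have hlim : ∀ α : Ordinal.{u}, ∃ c, ∀ᶠ x in U, g x (f α x) = c := fun α => by
    refine hU.exists_eventually_eq ?_ _
    rw [Cardinal.mk_Iio_ordinal, Cardinal.card_ord]
    simpa using (Cardinal.natCast_lt_aleph0 (n := 2)).trans hκ
  choose G hG using hlim
  have hbig := hU.eventually_le_mk hle hω₁
  intro hFr
  obtain ⟨h, hn, c, hc⟩ := hFr (fun α => G α) <| by
    intro α hpos
    obtain ⟨x, ⟨hx, hmem⟩, hxG⟩ := ((hbig.and (hU.fine (i α 0))).and (hG α)).exists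
    -- As `i α 0 ∈ x`, the ordinal `f α x` is positive, and `g x` is regressive there.
    have h0 : 0 < f α x := lt_initialOrderType_iff.2 ⟨0, hpos, hmem, zero_le⟩
    have := (hg x hx).1 _ (initialOrderType_preimage_lt (hi α α.2)) h0
    rw [hxG] at this
    exact this.trans_le (initialOrderType_le _ _)
  have hcard : Cardinal.lift.{u} #(Set.Iio (ω₁ : Ordinal.{u})) < Cardinal.lift.{u + 1} κ := by
    rw [Cardinal.mk_Iio_ordinal]
    simpa using hω₁
  have hcol : ∀ᶠ x in U, ∀ j, g x (f (h j) x) = c :=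
    hU.eventually_forall hcard fun j => by simpa [← hc j] using hG (h j)
  have hcoh : ∀ᶠ x : SmallSubsets κ lam in U, ∀ j k, j < k →
      ∀ ξ < (h j : Ordinal.{u}), ξ ∈ i (h j) ⁻¹' x.1 ↔ ξ ∈ i (h k) ⁻¹' x.1 := by
    refine hU.eventually_forall hcard fun j => hU.eventually_forall hcard fun k => ?_
    by_cases hjk : j < k
    · have hsub : Set.Iio (h j : Ordinal.{u}) ⊆ Set.Iio (h k : Ordinal.{u}) :=
        Set.Iio_subset_Iio (hn.monotone hjk.le)
      filter_upwards [hU.eventually_coherent (hi _ (h j).2) ((hi _ (h k).2).mono hsub)]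
        with x hx _ ξ hξ using hx ξ hξ
    · exact Eventually.of_forall fun x hlt => absurd hlt hjk
  have hmem : ∀ᶠ x : SmallSubsets κ lam in U, ∀ j k, (h j : Ordinal.{u}) ∈ i (h k) ⁻¹' x.1 :=
    hU.eventually_forall hcard fun j => hU.eventually_forall hcard fun k => hU.fine _
  obtain ⟨x, ⟨⟨hx, hxcol⟩, hxcoh⟩, hxmem⟩ := (((hbig.and hcol).and hcoh).and hmem).exists
  obtain ⟨j, hj⟩ := (hg x hx).2
    (fun j => ⟨f (h j) x, initialOrderType_preimage_lt (hi _ (h j).2)⟩)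
    (hn.initialOrderType_comp (A := fun j => i (h j) ⁻¹' x.1) (fun _ => rfl) hxcoh
      fun j k _ => hxmem j k) c
  exact hj (hxcol j)
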